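/- **Setting.** For positive integers $n,d$ and $K\ge 2$ and an activation $\sigma:\mathbb R\to\mathbb R$ applied coordinatewise, consider the bias-free two-layer networks with scores $s_{V_1,V_2}(x)=V_2\,\sigma(V_1x)\in\mathbb R^K$, where $V_1\in\mathbb R^{d\times n}$, $V_2\in\mathbb R^{K\times d}$, with $W=Kd+dn$ parameters. Let $\mathcal X\subseteq\mathbb R^n$ be the input domain. A *decoder* is either an *argmax decoder*, i.e. any map $\psi:\mathbb R^K\to[K]$ with $\psi(u)\in\arg\max_k u_k$ for all $u$ (ties broken by an arbitrary fixed rule), or the *strict decoder* $\psi_{\mathrm{uargmax}}$, which returns the index of the maximum if it is unique and the invalid symbol $\bot\notin[K]$ otherwise. Put $$\mathcal H_\psi=\{x\mapsto\psi(s_{V_1,V_2}(x))\},\qquad \mathcal M=\{x\mapsto \mathbf 1\{\langle v,\sigma(V_1x)\rangle\ge 0\}: V_1\in\mathbb R^{d\times n},\,v\in\mathbb R^d\},$$ as classes of functions on $\mathcal X$. $\mathrm{VCdim}$ is the supremum of the sizes of finite shattered sets. $\mathrm{Ndim}(\mathcal H)$ is the supremum of the sizes of finite sets $S$ for which there are $f_1,f_2:S\to[K]$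 with $f_1(x)\ne f_2(x)$ for all $x\in S$ such that for every $b:S\to\{1,2\}$ some $h\in\mathcal H$ satisfies $h(x)=f_{b(x)}(x)$ for all $x\in S$. A function $\sigma$ is *piecewise polynomial of degree at most $r$* if there are finitely many breakpoints $b_1<\dots<b_m$ such that $\sigma$ agrees with a polynomial of degree at most $r$ on each of $(-\infty,b_1],(b_1,b_2],\dots,(b_m,\infty)$, and *piecewise linear* if this holds with $r=1$. **Theorem.** (a) For every $\sigma$, every $\mathcal X\subseteq\mathbb R^n$, every $K\ge2$ and every argmax decoder $\psi$, $\mathrm{Ndim}(\mathcal H_\psi)\ge\mathrm{VCdim}(\mathcal M)$. If $\sigma>0$ everywhere (e.g. the standard sigmoid), the same holds for $\psi=\psi_{\mathrm{uargmax}}$. (b) The following lower bounds hold for every decoder $\psi$ (argmax or strict). 1. *(Piecewise linear, $\mathcal X=\mathbb R^n$.)* There is an absolute constant $c>0$ such that for all $K\ge2$ and $\alpha>0$ there is $W_0$ such that for every piecewise linear $\sigma$ that is not affine on $\mathbb R$, and all $n,d$ with $W=Kd+dn\ge W_0$ and $W^{\alpha}\le d\le W^{1-\alpha}$, $\mathrm{Ndim}(\mathcal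 H_\psi)\ge c\,\alpha\,W\log W$. 2. *(Piecewise polynomial, $\mathcal X=\mathbb R^n$.)* For every $r$ there is $c>0$, depending only on $r$, such that for all $K\ge2$ and $\alpha>0$ there is $W_0$ such that for every $\sigma$ that is piecewise polynomial of degree at most $r$ and is not a polynomial on $\mathbb R$, and all $n,d$ with $W=Kd+dn\ge W_0$ and $W^{\alpha}\le d\le W^{1-\alpha}$, $\mathrm{Ndim}(\mathcal H_\psi)\ge c\,\alpha\,W\log W$. 3. *(Standard sigmoid $\sigma(t)=1/(1+e^{-t})$, $\mathcal X=\mathbb R^n$.)* There is an absolute constant $c>0$ such that for all $K\ge2$ and $\alpha>0$ there is $W_0$ such that for all $n,d$ with $W=Kd+dn\ge W_0$ and $W^{\alpha}\le d\le W^{1-\alpha}$, $\mathrm{Ndim}(\mathcal H_\psi)\ge c\,\alpha\,W\log W$. 4. *(Standard sigmoid, $\mathcal X=\{x\in\mathbb Z^n:\|x\|_\infty\le M\}$.)* There is an absolute constant $c>0$ such that for all $K\ge2$ and $\alpha>0$ there is $W_0$ such that for all $M\ge1$ and all $n,d$ with $W=Kd+dn\ge W_0$ and $2\le d\le W^{1-\alpha}$,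 $\mathrm{Ndim}(\mathcal H_\psi)\ge c\,W$. 5. *(Sine, $\mathcal X=\mathbb Z^n$.)* For all $n,d\ge1$ and $K\ge2$, $\mathrm{Ndim}(\mathcal H_\psi)=\infty$. -/

import Mathlib

open scoped ENNReal

namespace TwoLayer

/-- A finite set `S` is shattered by a binary class `B` on `X` (a hypothesis is the predicate
"the label is 1"): every labelling of `S` is realized by a member of `B`. -/
def VCShatters {X : Type*} (B : Set (X → Prop)) (S : Finset X) : Prop :=
  ∀ y : S → Prop, ∃ h ∈ B, ∀ x : S, h x ↔ y x

/-- VC dimension: the supremum (possibly `⊤`) of the sizes of shattered finite sets. -/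
noncomputable def vcDim {X : Type*} (B : Set (X → Prop)) : ℕ∞ :=
  ⨆ (S : Finset X) (_ : VCShatters B S), (S.card : ℕ∞)

/-- Natarajan shattering, for hypotheses with values in `Y ∪ {⊥}` (`none` is the invalid
prediction `⊥`, which is not a label). The witnesses take values in the label set `Y`. -/
def NShatters {X Y : Type*} (H : Set (X → Option Y)) (S : Finset X) : Prop :=
  ∃ f₁ f₂ : S → Y, (∀ x, f₁ x ≠ f₂ x) ∧
    ∀ b : S → Bool, ∃ h ∈ H, ∀ x : S, h x = some (if b x then f₁ x else f₂ x)

/-- Natarajan dimension: the supremum (possibly `⊤`) of the sizes of N-shattered finite sets. -/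
noncomputable def natarajanDim {X Y : Type*} (H : Set (X → Option Y)) : ℕ∞ :=
  ⨆ (S : Finset X) (_ : NShatters H S), (S.card : ℕ∞)

/-- The hidden representation `σ(V₁ x)` of a bias-free network of width `d`. -/
def hidden {n d : ℕ} (σ : ℝ → ℝ) (V₁ : Matrix (Fin d) (Fin n) ℝ) (x : Fin n → ℝ) : Fin d → ℝ :=
  fun j => σ (V₁.mulVec x j)

/-- The score vector `V₂ σ(V₁ x)`. -/
def score {n d K : ℕ} (σ : ℝ → ℝ) (V₁ : Matrix (Fin d) (Fin n) ℝ)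
    (V₂ : Matrix (Fin K) (Fin d) ℝ) (x : Fin n → ℝ) : Fin K → ℝ :=
  V₂.mulVec (hidden σ V₁ x)

/-- The number of trainable parameters `W = Kd + dn`. -/
def numParams (n d K : ℕ) : ℕ := K * d + d * n

/-- The strict decoder: the index of the unique maximum, or `⊥` if the maximum is not unique. -/
noncomputable def uargmax {K : ℕ} (u : Fin K → ℝ) : Option (Fin K) :=
  open Classical in
  if h : ∃ k, ∀ j, j ≠ k → u j < u k then some h.choose else none

/-- An argmax decoder: it always returns a label of maximal score (ties broken by any fixed
rule, for instance in favour of the smallest index). -/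
def IsArgmaxDecoder {K : ℕ} (ψ : (Fin K → ℝ) → Option (Fin K)) : Prop :=
  ∀ u, ∃ k, ψ u = some k ∧ ∀ j, u j ≤ u k

/-- The decoders under consideration: the strict one, and every argmax decoder. -/
def IsDecoder {K : ℕ} (ψ : (Fin K → ℝ) → Option (Fin K)) : Prop :=
  ψ = uargmax ∨ IsArgmaxDecoder ψ

/-- The multiclass hypothesis class on the input domain `X`: all `x ↦ ψ (V₂ σ(V₁ x))`. -/
def multiclass (n d K : ℕ) (σ : ℝ → ℝ) (X : Set (Fin n → ℝ))
    (ψ : (Fin K → ℝ) → Option (Fin K)) : Set (X → Option (Fin K)) :=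
  {h | ∃ (V₁ : Matrix (Fin d) (Fin n) ℝ) (V₂ : Matrix (Fin K) (Fin d) ℝ),
    h = fun x : X => ψ (score σ V₁ V₂ x)}

/-- The associated binary class on `X`: all `x ↦ 1{⟨v, σ(V₁ x)⟩ ≥ 0}`. -/
def halfspaceClass (n d : ℕ) (σ : ℝ → ℝ) (X : Set (Fin n → ℝ)) : Set (X → Prop) :=
  {h | ∃ (V₁ : Matrix (Fin d) (Fin n) ℝ) (v : Fin d → ℝ),
    h = fun x : X => 0 ≤ v ⬝ᵥ hidden σ V₁ x}

/-- All integer vectors. -/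
def intInputs (n : ℕ) : Set (Fin n → ℝ) :=
  {x | ∃ z : Fin n → ℤ, ∀ i, x i = z i}

/-- All integer vectors of sup norm at most `M`. -/
def boundedIntInputs (n M : ℕ) : Set (Fin n → ℝ) :=
  {x | ∃ z : Fin n → ℤ, ∀ i, x i = z i ∧ |z i| ≤ M}

/-- `σ` is piecewise polynomial with pieces of degree at most `r`: there are finitely many
breakpoints `b 0 < ⋯ < b (m - 1)`, and on the `l`-th of the intervals
`(-∞, b 0], (b 0, b 1], …, (b (m - 1), ∞)` the function is a polynomial of degree at most `r`. -/
def IsPiecewisePolynomial (r : ℕ) (σ : ℝ → ℝ) : Prop :=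
  ∃ (m : ℕ) (b : Fin m → ℝ) (P : Fin (m + 1) → Polynomial ℝ),
    StrictMono b ∧ (∀ l, (P l).natDegree ≤ r) ∧
    ∀ (l : Fin (m + 1)) (t : ℝ),
      (∀ i : Fin m, (i : ℕ) < l → b i < t) → (∀ i : Fin m, (l : ℕ) ≤ i → t ≤ b i) →
      σ t = (P l).eval t

/-- Piecewise linear: piecewise polynomial with pieces of degree at most one. -/
def IsPiecewiseLinear (σ : ℝ → ℝ) : Prop := IsPiecewisePolynomial 1 σ

end TwoLayer

namespace TwoLayer

/-! ### Decoders -/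

/-! Give one label the output row `v`, a second label `-v`, and all others zero. A nonzero `⟨v, σ(V₁
x)⟩` then makes one of the two labels the unique maximizer, so every decoder follows its sign.
Natarajan shattering thus reduces to realizing all sign patterns strictly (`FamilyShatters`); only
part (a) has to handle zeros.

For `W log W`, take `m = q * 2 ^ L` points of the moment curve, each paired with each of `L` unit
vectors. A labelling gives every moment point a string of `L` bits. Group the points by string and
cut the groups into at most `m / q + 2 ^ L` chunks of size at most `q`. A polynomial of degree at
most `q` vanishing on a chunk is linear on the moment curve, and a large weight on the unit vectors
with bit 0 removes unwanted zeros. The positive points are therefore exactly those on some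
hyperplane (`exists_hyperplanes`). Since `p` units make a bump detecting a zero (`HasBump`), about
`2 * p * 2 ^ L` units shatter `q * 2 ^ L * L` points. With `q` of order `n` and `2 ^ L` of order `d
/ p`, this is of order `d n log d`.

A sigmoid needs steep slopes to make such bumps, and two units suffice; a piecewise polynomial uses
a finite difference across a breakpoint. For bounded integer inputs one sigmoid unit per group,
recognizing its group by a sign vector, stores `q` labels. For sine, the binary digits of one
frequency encode every labelling. -/

lemma uargmax_eq_some {K : ℕ} {u : Fin K → ℝ} {k : Fin K} (h : ∀ j, j ≠ k → u j < u k) :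
    uargmax u = some k := by
  have hex : ∃ k, ∀ j, j ≠ k → u j < u k := ⟨k, h⟩
  rw [uargmax, dif_pos hex]
  congr 1
  by_contra hne
  exact lt_asymm (h _ hne) (hex.choose_spec k (Ne.symm hne))

lemma IsArgmaxDecoder.eq_some {K : ℕ} {ψ : (Fin K → ℝ) → Option (Fin K)}
    (hψ : IsArgmaxDecoder ψ) {u : Fin K → ℝ} {k : Fin K} (h : ∀ j, j ≠ k → u j < u k) :
    ψ u = some k := by
  obtain ⟨l, hl, hmax⟩ := hψ u
  rw [hl]
  congr 1
  by_contra hne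
  exact absurd (hmax k) (not_le.2 (h l hne))

lemma IsDecoder.eq_some {K : ℕ} {ψ : (Fin K → ℝ) → Option (Fin K)}
    (hψ : IsDecoder ψ) {u : Fin K → ℝ} {k : Fin K} (h : ∀ j, j ≠ k → u j < u k) :
    ψ u = some k := by
  rcases hψ with rfl | hψ
  · exact uargmax_eq_some h
  · exact hψ.eq_some h

/-- The output matrix with row `v` for the label `k₀`, row `-v` for the label `k₁`, and zero rows
for all other labels. -/
def oppositeRows {d K : ℕ} (k₀ k₁ : Fin K) (v : Fin d → ℝ) : Matrix (Fin K) (Fin d) ℝ :=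
  fun k => if k = k₀ then v else if k = k₁ then -v else 0

lemma score_oppositeRows {n d K : ℕ} (σ : ℝ → ℝ) (V₁ : Matrix (Fin d) (Fin n) ℝ)
    (k₀ k₁ : Fin K) (v : Fin d → ℝ) (x : Fin n → ℝ) :
    score σ V₁ (oppositeRows k₀ k₁ v) x = fun k =>
      if k = k₀ then v ⬝ᵥ hidden σ V₁ x
      else if k = k₁ then -(v ⬝ᵥ hidden σ V₁ x) else 0 := by
  funext k
  simp only [score, Matrix.mulVec, oppositeRows]
  split_ifs
  · rfl
  · exact neg_dotProduct _ _
  · exact zero_dotProduct _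

lemma IsDecoder.oppositeRows_of_pos {n d K : ℕ} {ψ : (Fin K → ℝ) → Option (Fin K)}
    (hψ : IsDecoder ψ) {σ : ℝ → ℝ} {V₁ : Matrix (Fin d) (Fin n) ℝ} (k₀ k₁ : Fin K)
    {v : Fin d → ℝ} {x : Fin n → ℝ} (h : 0 < v ⬝ᵥ hidden σ V₁ x) :
    ψ (score σ V₁ (oppositeRows k₀ k₁ v) x) = some k₀ := by
  refine hψ.eq_some fun j hj => ?_
  rw [score_oppositeRows]
  simp only [hj, if_true, if_false]
  split_ifs <;> linarith

lemma IsDecoder.oppositeRows_of_neg {n d K : ℕ} {ψ : (Fin K → ℝ) → Option (Fin K)}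
    (hψ : IsDecoder ψ) {σ : ℝ → ℝ} {V₁ : Matrix (Fin d) (Fin n) ℝ} {k₀ k₁ : Fin K}
    (hk : k₀ ≠ k₁) {v : Fin d → ℝ} {x : Fin n → ℝ} (h : v ⬝ᵥ hidden σ V₁ x < 0) :
    ψ (score σ V₁ (oppositeRows k₀ k₁ v) x) = some k₁ := by
  refine hψ.eq_some fun j hj => ?_
  rw [score_oppositeRows]
  simp only [hj, hk.symm, if_true, if_false]
  split_ifs <;> linarith

/-! ### Comparison with the binary class -/

/-- `S` is strictly shattered by the linear functionals of the hidden representation: every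
labelling is the sign pattern of a network that does not vanish on `S`. -/
def StrictShatters {n : ℕ} (d : ℕ) (σ : ℝ → ℝ) {X : Set (Fin n → ℝ)} (S : Finset X) : Prop :=
  ∀ y : S → Prop, ∃ (V₁ : Matrix (Fin d) (Fin n) ℝ) (v : Fin d → ℝ), ∀ x : S,
    (y x → 0 < v ⬝ᵥ hidden σ V₁ x) ∧ (¬ y x → v ⬝ᵥ hidden σ V₁ x < 0)

lemma StrictShatters.nShatters {n d K : ℕ} (hK : 2 ≤ K) {σ : ℝ → ℝ} {X : Set (Fin n → ℝ)}
    {S : Finset X} (hS : StrictShatters d σ S) {ψ : (Fin K → ℝ) → Option (Fin K)}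
    (hψ : IsDecoder ψ) : NShatters (multiclass n d K σ X ψ) S := by
  have hk : (⟨0, by omega⟩ : Fin K) ≠ ⟨1, by omega⟩ := by simp
  refine ⟨fun _ => ⟨0, by omega⟩, fun _ => ⟨1, by omega⟩, fun _ => hk, fun b => ?_⟩
  obtain ⟨V₁, v, h⟩ := hS fun x => b x = true
  refine ⟨_, ⟨V₁, oppositeRows ⟨0, by omega⟩ ⟨1, by omega⟩ v, rfl⟩, fun x => ?_⟩
  by_cases hb : b x = true
  · simpa [hb] using hψ.oppositeRows_of_pos _ _ ((h x).1 hb)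
  · simpa [hb] using hψ.oppositeRows_of_neg hk ((h x).2 hb)

/-- The binary class counts 0 as positive. At 0 all scores tie, so `k₀` must be the label that the
decoder itself picks at the zero vector. -/
lemma nShatters_of_vcShatters_of_isArgmaxDecoder {n d K : ℕ} (hK : 2 ≤ K) {σ : ℝ → ℝ}
    {X : Set (Fin n → ℝ)} {ψ : (Fin K → ℝ) → Option (Fin K)} (hψ : IsArgmaxDecoder ψ)
    {S : Finset X} (hS : VCShatters (halfspaceClass n d σ X) S) :
    NShatters (multiclass n d K σ X ψ) S := by
  obtain ⟨k₀, hk₀, -⟩ := hψ 0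
  have : Nontrivial (Fin K) := Fin.nontrivial_iff_two_le.2 hK
  obtain ⟨k₁, hk₁⟩ := exists_ne k₀
  refine ⟨fun _ => k₀, fun _ => k₁, fun _ => hk₁.symm, fun b => ?_⟩
  obtain ⟨_, ⟨V₁, v, rfl⟩, h⟩ := hS fun x => b x = true
  refine ⟨_, ⟨V₁, oppositeRows k₀ k₁ v, rfl⟩, fun x => ?_⟩
  have hx := h x
  by_cases hb : b x = true
  · rcases (hx.2 hb).eq_or_lt with h0 | hpos
    · have : score σ V₁ (oppositeRows k₀ k₁ v) x = 0 := by
        rw [score_oppositeRows, ← h0]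
        funext k
        simp
      simpa [hb, this] using hk₀
    · simpa [hb] using IsDecoder.oppositeRows_of_pos (Or.inr hψ) k₀ k₁ hpos
  · have hneg : v ⬝ᵥ hidden σ V₁ x < 0 := not_le.1 fun h0 => hb (hx.1 h0)
    simpa [hb] using IsDecoder.oppositeRows_of_neg (Or.inr hψ) hk₁.symm hneg

/-- Adding a small multiple of the all-ones vector to `v` strictly raises every value, because the
hidden units are positive, and keeps the finitely many negative values negative. -/
lemma strictShatters_of_vcShatters {n d : ℕ} {σ : ℝ → ℝ} (hσ : ∀ t, 0 < σ t)
    {X : Set (Fin n → ℝ)} {S : Finset X} (hS : VCShatters (halfspaceClass n d σ X) S) :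
    StrictShatters d σ S := by
  intro y
  rcases Nat.eq_zero_or_pos d with rfl | hd
  -- With no hidden units the value is always 0, so the all-false labelling forces `S` to be empty.
  · refine ⟨0, 0, fun x => ?_⟩
    obtain ⟨_, ⟨V₁, v, rfl⟩, h⟩ := hS fun _ => False
    have := h x
    simp [dotProduct] at this
  have : Nonempty (Fin d) := ⟨⟨0, hd⟩⟩
  obtain ⟨_, ⟨V₁, v, rfl⟩, h⟩ := hS y
  have hpos : ∀ x : S, 0 < (fun _ => (1 : ℝ)) ⬝ᵥ hidden σ V₁ x := fun x => by
    simp only [dotProduct, one_mul]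
    exact Finset.sum_pos (fun j _ => hσ _) Finset.univ_nonempty
  have hev : ∀ᶠ ε : ℝ in nhdsWithin 0 (Set.Ioi 0), ∀ x : S, ¬ y x →
      (v + ε • fun _ => (1 : ℝ)) ⬝ᵥ hidden σ V₁ x < 0 := by
    refine Filter.eventually_all.2 fun x => Filter.eventually_imp_distrib_left.2 fun hy => ?_
    have hneg : v ⬝ᵥ hidden σ V₁ x < 0 := not_le.1 fun h0 => hy ((h x).1 h0)
    have hcont : Continuous fun ε : ℝ => (v + ε • fun _ => (1 : ℝ)) ⬝ᵥ hidden σ V₁ x := by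
      simp only [add_dotProduct, smul_dotProduct]
      fun_prop
    refine nhdsWithin_le_nhds (hcont.continuousAt.eventually_lt continuousAt_const ?_)
    simpa using hneg
  obtain ⟨ε, hε, hε0⟩ := (hev.and self_mem_nhdsWithin).exists
  refine ⟨V₁, v + ε • fun _ => (1 : ℝ), fun x => ⟨fun hy => ?_, hε x⟩⟩
  have h0 : 0 ≤ v ⬝ᵥ hidden σ V₁ x := (h x).2 hy
  rw [add_dotProduct, smul_dotProduct, smul_eq_mul]
  exact add_pos_of_nonneg_of_pos h0 (mul_pos hε0 (hpos x))

lemma NShatters.card_le {X Y : Type*} {H : Set (X → Option Y)} {S : Finset X}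
    (hS : NShatters H S) : (S.card : ℕ∞) ≤ natarajanDim H :=
  le_iSup₂ (f := fun (S : Finset X) (_ : NShatters H S) => (S.card : ℕ∞)) S hS

lemma vcDim_le_natarajanDim {X Y : Type*} {B : Set (X → Prop)} {H : Set (X → Option Y)}
    (h : ∀ S, VCShatters B S → NShatters H S) : vcDim B ≤ natarajanDim H :=
  iSup₂_le fun S hS => (h S hS).card_le

/-! ### Networks indexed by finite types -/

lemma dotProduct_extend {ι : Type*} [Fintype ι] {n : ℕ} (e : ι ↪ Fin n) (w p : ι → ℝ) :
    Function.extend e w 0 ⬝ᵥ Function.extend e p 0 = w ⬝ᵥ p := by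
  classical
  simp only [dotProduct]
  symm
  refine Fintype.sum_of_injective e e.injective _ _ (fun j hj => ?_) (fun i => ?_)
  · rw [Function.extend_apply' _ _ _ (by simpa using hj)]
    simp
  · simp [e.injective.extend_apply]

/-- A family of points `P` in `ℝ^ι` is strictly shattered by `d` hidden units: each labelling is
the sign pattern of a network with at most `d` units and a non-vanishing output. -/
def FamilyShatters {T ι : Type*} [Fintype ι] (d : ℕ) (σ : ℝ → ℝ) (P : T → ι → ℝ) : Prop :=
  ∀ y : T → Prop, ∃ (κ : Type) (_ : Fintype κ) (w : κ → ι → ℝ) (v : κ → ℝ),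
    Fintype.card κ ≤ d ∧
      ∀ t, (y t → 0 < ∑ k, v k * σ (w k ⬝ᵥ P t)) ∧ (¬ y t → ∑ k, v k * σ (w k ⬝ᵥ P t) < 0)

/-- Pad with zeros: extra input coordinates vanish, and surplus units get output weight 0, so the
value `σ 0` plays no role. -/
lemma FamilyShatters.card_le_natarajanDim {T ι : Type*} [Fintype T] [Fintype ι] {n d K : ℕ}
    (hK : 2 ≤ K) {σ : ℝ → ℝ} {P : T → ι → ℝ} (hP : FamilyShatters d σ P)
    (e : ι ↪ Fin n) {X : Set (Fin n → ℝ)} (hX : ∀ t, Function.extend e (P t) 0 ∈ X)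
    {ψ : (Fin K → ℝ) → Option (Fin K)} (hψ : IsDecoder ψ) :
    (Fintype.card T : ℕ∞) ≤ natarajanDim (multiclass n d K σ X ψ) := by
  classical
  have hinj : Function.Injective P := by
    intro s t hst
    by_contra hne
    obtain ⟨κ, _, w, v, -, h⟩ := hP fun u => u = s
    have h1 := (h s).1 rfl
    have h2 := (h t).2 (Ne.symm hne)
    rw [hst] at h1
    exact lt_asymm h1 h2
  let f : T ↪ X := ⟨fun t => ⟨Function.extend e (P t) 0, hX t⟩, fun s t hst =>
    hinj (Function.extend_injective e.injective (0 : Fin n → ℝ) (congrArg Subtype.val hst :))⟩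
  have hS : StrictShatters d σ (Finset.univ.map f) := by
    intro y
    obtain ⟨κ, _, w, v, hκ, h⟩ := hP fun t => y ⟨f t, by simp⟩
    obtain ⟨g⟩ : Nonempty (κ ↪ Fin d) :=
      Function.Embedding.nonempty_of_card_le (by simpa using hκ)
    refine ⟨fun j => Function.extend e (Function.extend g w 0 j) 0, Function.extend g v 0, ?_⟩
    rintro ⟨x, hx⟩
    obtain ⟨t, -, rfl⟩ := Finset.mem_map.1 hx
    have key : (Function.extend g v 0) ⬝ᵥ hidden σ
        (fun j => Function.extend e (Function.extend g w 0 j) 0 : Matrix (Fin d) (Fin n) ℝ)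
        (f t : Fin n → ℝ) = ∑ k, v k * σ (w k ⬝ᵥ P t) := by
      simp only [dotProduct]
      symm
      refine Fintype.sum_of_injective g g.injective _ _ (fun j hj => ?_) (fun k => ?_)
      · rw [Function.extend_apply' _ _ _ (by simpa using hj)]
        simp
      · rw [g.injective.extend_apply]
        congr 2
        simp only [Matrix.mulVec, g.injective.extend_apply]
        exact (dotProduct_extend e _ _).symm
    rw [key]
    exact h t
  simpa using (hS.nShatters hK hψ).card_le

/-! ### Bumps -/

/-- `p` units with activation `σ` suffice for a bump at `0`: a combination of `p` shifted copies of
a dilation of `σ` that is `1` at `0` and at most `ε` in absolute value on a given finite set of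
nonzero reals. -/
def HasBump (σ : ℝ → ℝ) (p : ℕ) : Prop :=
  ∀ U : Finset ℝ, 0 ∉ U → ∀ ε : ℝ, 0 < ε → ∃ (a : ℝ) (β c : Fin p → ℝ),
    ∑ i, c i * σ (β i) = 1 ∧ ∀ u ∈ U, |∑ i, c i * σ (a * u + β i)| ≤ ε

/-- For `u ≠ 0` the two shifted sigmoids have the same limit as the slope `a` grows, so their
difference dies; at `u = 0` it is the constant `D > 0`. -/
lemma hasBump_sigmoid : HasBump Real.sigmoid 2 := by
  intro U hU ε hε
  set D := Real.sigmoid 1 - Real.sigmoid (-1) with hD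
  have hDpos : 0 < D := sub_pos.2 (Real.sigmoid_lt (by norm_num))
  have hev : ∀ᶠ a : ℝ in Filter.atTop, ∀ u ∈ U,
      |D⁻¹ * Real.sigmoid (a * u + 1) + -D⁻¹ * Real.sigmoid (a * u + -1)| < ε := by
    refine (Filter.eventually_all_finset U).2 fun u hu => ?_
    have hu0 : u ≠ 0 := fun h => hU (h ▸ hu)
    have hlim : ∃ l, ∀ b : ℝ, Filter.Tendsto (fun a : ℝ => Real.sigmoid (a * u + b))
        Filter.atTop (nhds l) := by
      rcases hu0.lt_or_gt with h | h
      · exact ⟨0, fun b => Real.tendsto_sigmoid_atBot.comp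
          (Filter.tendsto_atBot_add_const_right _ _ (Filter.tendsto_id.atTop_mul_const_of_neg h))⟩
      · exact ⟨1, fun b => Real.tendsto_sigmoid_atTop.comp
          (Filter.tendsto_atTop_add_const_right _ _ (Filter.tendsto_id.atTop_mul_const h))⟩
    obtain ⟨l, hl⟩ := hlim
    have := (((hl 1).const_mul D⁻¹).add ((hl (-1)).const_mul (-D⁻¹))).abs
    rw [neg_mul, add_neg_cancel, abs_zero] at this
    exact this.eventually_lt_const hε
  obtain ⟨a, ha⟩ := hev.exists
  refine ⟨a, ![1, -1], ![D⁻¹, -D⁻¹], ?_, fun u hu => ?_⟩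
  · simp only [Fin.sum_univ_two, Matrix.cons_val_zero, Matrix.cons_val_one]
    rw [neg_mul, ← sub_eq_add_neg, ← mul_sub, ← hD, inv_mul_cancel₀ hDpos.ne']
  · simpa [Fin.sum_univ_two] using (ha u hu).le

/-- The `n`-th finite difference with step `δ` annihilates polynomials of degree below `n`. -/
lemma sum_alternating_choose_mul_eval_eq_zero {P : Polynomial ℝ} {n : ℕ} (hP : P.natDegree < n)
    (y δ : ℝ) :
    ∑ k ∈ Finset.range (n + 1), ((-1) ^ (n - k) * (n.choose k : ℝ)) * P.eval (y + k * δ) = 0 := by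
  have hdeg : (P.comp (Polynomial.C δ * Polynomial.X + Polynomial.C y)).natDegree < n := by
    refine (Polynomial.natDegree_comp_le.trans ?_).trans_lt hP
    exact (Nat.mul_le_mul_left _ Polynomial.natDegree_linear_le).trans_eq (mul_one _)
  have h := congrFun (Polynomial.fwdDiff_iter_eq_zero_of_degree_lt hdeg) 0
  rw [fwdDiff_iter_eq_sum_shift] at h
  simp only [Pi.zero_apply] at h
  rw [← h]
  refine Finset.sum_congr rfl fun k _ => ?_
  simp only [Polynomial.eval_comp, zsmul_eq_mul]
  push_cast
  congr 2
  simp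
  ring

/-- A function given by two different polynomials to the left and to the right of `τ`. -/
lemma hasBump_of_distinct_polynomials {σ : ℝ → ℝ} {r : ℕ} {τ η : ℝ} (hη : 0 < η)
    {P Q : Polynomial ℝ} (hP : P.natDegree ≤ r) (hQ : Q.natDegree ≤ r) (hPQ : P ≠ Q)
    (hl : ∀ t, τ - η < t → t ≤ τ → σ t = P.eval t)
    (hr : ∀ t, τ < t → t < τ + η → σ t = Q.eval t) : HasBump σ (r + 2) := by
  intro U hU ε hε
  obtain ⟨B, hB⟩ : ∃ B : ℝ, 0 < B ∧ ∀ u ∈ U, |u| ≤ B :=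
    ⟨1 + ∑ u ∈ U, |u|, by positivity, fun u hu =>
      (Finset.single_le_sum (f := fun u : ℝ => |u|) (fun _ _ => abs_nonneg _) hu).trans
        (by linarith)⟩
  obtain ⟨m, hm⟩ : ∃ m : ℝ, 0 < m ∧ ∀ u ∈ U, m < |u| := by
    have hev : ∀ᶠ m : ℝ in nhdsWithin 0 (Set.Ioi 0), ∀ u ∈ U, m < |u| :=
      (Filter.eventually_all_finset U).2 fun u hu =>
        nhdsWithin_le_nhds (eventually_lt_nhds (abs_pos.2 fun h => hU (h ▸ hu)))
    obtain ⟨m, h1, h2⟩ := (hev.and self_mem_nhdsWithin).exists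
    exact ⟨m, h2, h1⟩
  obtain ⟨hB0, hB⟩ := hB
  obtain ⟨hm0, hm⟩ := hm
  -- The scale `a` keeps `a * u` within `η / 2` of 0. The step `δ` is so small that for `u ∈ U` the
  -- shift `a * u` moves all `r + 2` nodes to one side of `τ`, where the difference vanishes
  -- exactly.
  set a : ℝ := η / (2 * B) with ha
  have ha0 : 0 < a := by positivity
  have haB : a * B = η / 2 := by rw [ha]; field_simp
  set δ : ℝ := min (a * m) (η / 2) / (r + 2) with hδ
  have hr2 : (0 : ℝ) < r + 2 := by positivity
  have hδ0 : 0 < δ := by positivity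
  have hδmul : (r + 2) * δ = min (a * m) (η / 2) := by rw [hδ]; field_simp
  have hδ1 : (r + 2) * δ ≤ a * m := hδmul.trans_le (min_le_left _ _)
  have hδ2 : (r + 2) * δ ≤ η / 2 := hδmul.trans_le (min_le_right _ _)
  obtain ⟨s, ⟨hs0, hs1⟩, hs⟩ : ∃ s ∈ Set.Ioc 0 δ, P.eval (τ + s) ≠ Q.eval (τ + s) := by
    by_contra! hcon
    apply hPQ
    refine Polynomial.eq_of_infinite_eval_eq P Q
      (((Set.Ioc_infinite hδ0).image (add_right_injective τ).injOn).mono ?_)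
    rintro _ ⟨s, hs, rfl⟩
    exact hcon s hs
  set D := Q.eval (τ + s) - P.eval (τ + s) with hD
  have hD0 : D ≠ 0 := sub_ne_zero.2 hs.symm
  -- The last node `y + (r + 1) * δ` equals `τ + s`; since `s ≤ δ`, it alone lies beyond `τ`. The
  -- difference at `u = 0` is then that of `P`, which is 0, plus the jump `D`.
  set y : ℝ := τ + s - (r + 1) * δ with hy
  let C : ℕ → ℝ := fun k => (-1) ^ (r + 1 - k) * ((r + 1).choose k : ℝ)
  refine ⟨a, fun i => y + i * δ, fun i => D⁻¹ * C i, ?_, fun u hu => ?_⟩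
  · rw [Fin.sum_univ_eq_sum_range (fun k => D⁻¹ * C k * σ (y + k * δ)) (r + 2),
      Finset.sum_range_succ]
    have hP0 := sum_alternating_choose_mul_eval_eq_zero (n := r + 1) (by omega : P.natDegree < _) y δ
    rw [Finset.sum_range_succ] at hP0
    have h1 : ∑ k ∈ Finset.range (r + 1), D⁻¹ * C k * σ (y + k * δ) =
        D⁻¹ * ∑ k ∈ Finset.range (r + 1), C k * P.eval (y + k * δ) := by
      rw [Finset.mul_sum]
      refine Finset.sum_congr rfl fun k hk => ?_
      have hk' : (k : ℝ) + 1 ≤ r + 1 := by exact_mod_cast Finset.mem_range.1 hk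
      have hk0 : (0 : ℝ) ≤ k * δ := by positivity
      rw [hl _ (by nlinarith) (by nlinarith), mul_assoc]
    have h2 : y + ((r + 1 : ℕ) : ℝ) * δ = τ + s := by rw [hy]; push_cast; ring
    have h3 : C (r + 1) = 1 := by simp [C]
    rw [h2] at hP0
    rw [h1, h2, h3, hr _ (by linarith) (by nlinarith)]
    have h4 : ∑ k ∈ Finset.range (r + 1), C k * P.eval (y + k * δ) = -P.eval (τ + s) := by
      simp only [Nat.sub_self, pow_zero, Nat.choose_self, Nat.cast_one, mul_one, one_mul] at hP0
      linarith
    rw [h4]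
    field_simp
    rw [hD]
    ring
  · have hmu := hm u hu
    have hBu : a * |u| ≤ η / 2 := haB ▸ mul_le_mul_of_nonneg_left (hB u hu) ha0.le
    have hau : a * m < a * |u| := mul_lt_mul_of_pos_left hmu ha0
    suffices h : ∃ R : Polynomial ℝ, R.natDegree ≤ r ∧ ∀ k ∈ Finset.range (r + 2),
        σ (a * u + (y + k * δ)) = R.eval ((a * u + y) + k * δ) by
      obtain ⟨R, hR, h⟩ := h
      rw [Fin.sum_univ_eq_sum_range (fun k => D⁻¹ * C k * σ (a * u + (y + k * δ))) (r + 2),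
        Finset.sum_congr rfl fun k hk => by rw [h k hk, mul_assoc], ← Finset.mul_sum,
        sum_alternating_choose_mul_eval_eq_zero (by omega : R.natDegree < r + 1)]
      simpa using hε.le
    have hrange : ∀ k ∈ Finset.range (r + 2), 0 ≤ (k : ℝ) * δ ∧ (k : ℝ) * δ ≤ (r + 1) * δ := by
      intro k hk
      have hk' : (k : ℝ) ≤ r + 1 := by exact_mod_cast Nat.lt_succ_iff.1 (Finset.mem_range.1 hk)
      exact ⟨by positivity, mul_le_mul_of_nonneg_right hk' hδ0.le⟩
    have hu0 : u ≠ 0 := fun h => hU (h ▸ hu)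
    rcases hu0.lt_or_gt with h | h
    · rw [abs_of_neg h] at hBu hau
      refine ⟨P, hP, fun k hk => ?_⟩
      obtain ⟨hk0, hk1⟩ := hrange k hk
      rw [hl _ (by linarith) (by linarith), add_assoc]
    · rw [abs_of_pos h] at hBu hau
      refine ⟨Q, hQ, fun k hk => ?_⟩
      obtain ⟨hk0, hk1⟩ := hrange k hk
      rw [hr _ (by linarith) (by linarith), add_assoc]

lemma exists_piece {m : ℕ} {b : Fin m → ℝ} (hb : StrictMono b) (t : ℝ) :
    ∃ l : Fin (m + 1), (∀ i : Fin m, (i : ℕ) < l → b i < t) ∧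
      ∀ i : Fin m, (l : ℕ) ≤ i → t ≤ b i := by
  classical
  let p : ℕ → Prop := fun l => ∀ i : Fin m, (i : ℕ) < l → b i < t
  have hp : p (Nat.findGreatest p m) :=
    Nat.findGreatest_spec (P := p) (Nat.zero_le m) fun i hi => absurd hi (Nat.not_lt_zero _)
  refine ⟨⟨Nat.findGreatest p m, Nat.lt_succ_of_le (Nat.findGreatest_le m)⟩, hp, fun i hi => ?_⟩
  by_contra! hlt
  have := Nat.le_findGreatest (P := p) (n := m) (m := i + 1) i.2 fun j hj =>
    (hb.monotone (Nat.lt_succ_iff.1 hj : j ≤ i)).trans_lt hlt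
  simp only at hi
  omega

/-- Some breakpoint separates two different polynomials, or else all pieces coincide; a
neighbourhood of it contains no other breakpoint. -/
lemma hasBump_of_isPiecewisePolynomial {r : ℕ} {σ : ℝ → ℝ} (hσ : IsPiecewisePolynomial r σ)
    (hne : ¬ ∃ P : Polynomial ℝ, P.natDegree ≤ r ∧ ∀ t, σ t = P.eval t) : HasBump σ (r + 2) := by
  obtain ⟨m, b, P, hb, hdeg, hP⟩ := hσ
  obtain ⟨l, hl⟩ : ∃ l : Fin m, P l.castSucc ≠ P l.succ := by
    by_contra! hcon
    have hall : ∀ l, P l = P 0 := fun l => by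
      induction l using Fin.induction with
      | zero => rfl
      | succ i ih => rw [← hcon i, ih]
    refine hne ⟨P 0, hdeg 0, fun t => ?_⟩
    obtain ⟨l, h1, h2⟩ := exists_piece hb t
    rw [hP l t h1 h2, hall]
  have hev : ∀ᶠ t in nhds (b l), ∀ i : Fin m, (i < l → b i < t) ∧ (l < i → t < b i) :=
    Filter.eventually_all.2 fun i =>
      (Filter.eventually_imp_distrib_left.2 fun h => eventually_gt_nhds (hb h)).and
        (Filter.eventually_imp_distrib_left.2 fun h => eventually_lt_nhds (hb h))
  obtain ⟨η, hη, hball⟩ := Metric.eventually_nhds_iff.1 hev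
  refine hasBump_of_distinct_polynomials hη (hdeg l.castSucc) (hdeg l.succ) hl
    (τ := b l) (fun t h1 h2 => ?_) (fun t h1 h2 => ?_)
  · have ht := hball (y := t) (by rw [Real.dist_eq, abs_lt]; constructor <;> linarith)
    refine hP _ t (fun i hi => (ht i).1 hi) fun i hi => ?_
    rcases (show l ≤ i from hi).eq_or_lt with rfl | h
    · exact h2
    · exact ((ht i).2 h).le
  · have ht := hball (y := t) (by rw [Real.dist_eq, abs_lt]; constructor <;> linarith)
    refine hP _ t (fun i hi => ?_) fun i hi => ((ht i).2 ?_).le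
    · rcases (show i ≤ l from Nat.lt_succ_iff.1 hi).eq_or_lt with rfl | h
      · exact h1
      · exact (ht i).1 h
    · exact Nat.lt_of_succ_le hi

/-! ### Real inputs -/

/-- Point `(i, b)` of the shattered family: the `i`-th point of the moment curve, together with
the `b`-th unit vector. -/
def momentPoint (q m L : ℕ) (t : Fin m × Fin L) : Fin (q + 1) ⊕ Fin L → ℝ :=
  Sum.elim (fun l => (t.1 : ℝ) ^ (l : ℕ)) (Pi.single t.2 1)

lemma exists_chunks {α : Type*} (A : Finset α) {q : ℕ} (hq : 0 < q) :
    ∃ g : A → Fin (A.card / q + 1), ∀ j, (Finset.univ.filter fun a => g a = j).card ≤ q := by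
  refine ⟨fun a => ⟨A.equivFin a / q,
    Nat.lt_succ_of_le (Nat.div_le_div_right (A.equivFin a).2.le)⟩, fun j => ?_⟩
  calc _ ≤ (Finset.Ico (j * q : ℕ) (j * q + q)).card := by
        refine Finset.card_le_card_of_injOn (fun a => (A.equivFin a : ℕ)) (fun a ha => ?_) ?_
        · have h : (A.equivFin a : ℕ) / q = j := by
            simpa [Fin.ext_iff] using ha
          have := Nat.div_add_mod (A.equivFin a : ℕ) q
          have h2 := Nat.mod_lt (A.equivFin a : ℕ) hq
          rw [h, mul_comm] at this
          simp only [Finset.coe_Ico, Set.mem_Ico]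
          omega
        · intro a _ a' _ h
          exact A.equivFin.injective (Fin.ext h)
    _ = q := by simp

/-- Any subset of the family is cut out by the union of few hyperplanes through the origin. -/
lemma exists_hyperplanes {q : ℕ} (hq : 0 < q) (m L : ℕ) (y : Fin m × Fin L → Prop) :
    ∃ (κ : Type) (_ : Fintype κ) (w : κ → Fin (q + 1) ⊕ Fin L → ℝ),
      Fintype.card κ ≤ m / q + 2 ^ L ∧ ∀ t, y t ↔ ∃ k, w k ⬝ᵥ momentPoint q m L t = 0 := by
  classical
  let A : (Fin L → Bool) → Finset (Fin m) := fun s =>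
    Finset.univ.filter fun i => (fun b => decide (y (i, b))) = s
  choose g hg using fun s => exists_chunks (A s) hq
  let chunk : (Σ s : Fin L → Bool, Fin ((A s).card / q + 1)) → Finset (Fin m) := fun k =>
    (Finset.univ.filter fun a : A k.1 => g k.1 a = k.2).map (Function.Embedding.subtype _)
  let p : (Σ s : Fin L → Bool, Fin ((A s).card / q + 1)) → Polynomial ℝ := fun k =>
    ∏ i ∈ chunk k, (Polynomial.X - Polynomial.C (i : ℝ))
  have hp : ∀ k (i : Fin m), (p k).eval (i : ℝ) = 0 ↔ i ∈ chunk k := fun k i => by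
    simp only [p, Polynomial.eval_prod, Finset.prod_eq_zero_iff, Polynomial.eval_sub,
      Polynomial.eval_X, Polynomial.eval_C, sub_eq_zero, Nat.cast_inj]
    exact ⟨fun ⟨j, hj, hij⟩ => Fin.ext hij ▸ hj, fun h => ⟨i, h, rfl⟩⟩
  have hdeg : ∀ k, (p k).natDegree < q + 1 := fun k => by
    rw [Polynomial.natDegree_prod_of_monic _ _ fun i _ => Polynomial.monic_X_sub_C _]
    simp only [Polynomial.natDegree_X_sub_C, Finset.sum_const, smul_eq_mul, mul_one]
    exact Nat.lt_succ_of_le ((Finset.card_map _).trans_le (hg k.1 k.2))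
  -- `B` exceeds every value of `|p k|` on the nodes, so adding it excludes a zero at the bits where
  -- the string is 0.
  let B : (Σ s : Fin L → Bool, Fin ((A s).card / q + 1)) → ℝ := fun k =>
    1 + ∑ i : Fin m, |(p k).eval (i : ℝ)|
  have hB : ∀ k (i : Fin m), |(p k).eval (i : ℝ)| < B k := fun k i =>
    (Finset.single_le_sum (f := fun i : Fin m => |(p k).eval (i : ℝ)|)
      (fun _ _ => abs_nonneg _) (Finset.mem_univ i)).trans_lt (by simp [B])
  have hw : ∀ k (t : Fin m × Fin L),
      (Sum.elim (fun l : Fin (q + 1) => (p k).coeff l) fun b => if k.1 b then 0 else B k) ⬝ᵥ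
        momentPoint q m L t = (p k).eval (t.1 : ℝ) + if k.1 t.2 then 0 else B k := fun k t => by
    rw [momentPoint, sumElim_dotProduct_sumElim, dotProduct_single, mul_one,
      Polynomial.eval_eq_sum_range' (hdeg k), dotProduct,
      Fin.sum_univ_eq_sum_range (fun l => (p k).coeff l * (t.1 : ℝ) ^ l)]
  refine ⟨_, inferInstance, fun k => Sum.elim (fun l : Fin (q + 1) => (p k).coeff l)
    fun b => if k.1 b then 0 else B k, ?_, fun t => ?_⟩
  · rw [Fintype.card_sigma]
    simp only [Fintype.card_fin, Finset.sum_add_distrib, Finset.sum_const, Finset.card_univ,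
      smul_eq_mul, mul_one, Fintype.card_pi, Fintype.card_bool, Finset.prod_const]
    refine Nat.add_le_add_right ?_ _
    -- The full chunks number at most `m / q` in total; the term `2 ^ L` already split off allows
    -- one remainder chunk per string.
    rw [Nat.le_div_iff_mul_le hq, Finset.sum_mul]
    calc ∑ s, (A s).card / q * q ≤ ∑ s, (A s).card :=
          Finset.sum_le_sum fun s _ => Nat.div_mul_le_self _ _
      _ = m := by
          rw [← Finset.card_eq_sum_card_fiberwise fun i _ => Finset.mem_coe.2 (Finset.mem_univ _)]
          simp
  · simp only [hw]
    constructor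
    · intro hy
      let s : Fin L → Bool := fun b => decide (y (t.1, b))
      have hmem : t.1 ∈ A s := by simp [A, s]
      refine ⟨⟨s, g s ⟨t.1, hmem⟩⟩, ?_⟩
      have hs : s t.2 = true := by simpa [s] using hy
      rw [(hp _ _).2, zero_add, if_pos hs]
      simp [chunk, hmem]
    · rintro ⟨k, hk⟩
      have hs : k.1 t.2 = true := by
        by_contra hs
        rw [if_neg hs] at hk
        have := neg_lt_of_abs_lt (hB k t.1)
        linarith
      rw [if_pos hs, add_zero, hp] at hk
      obtain ⟨a, -, ha⟩ := Finset.mem_map.1 hk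
      have hA : t.1 ∈ A k.1 := ha ▸ a.2
      rw [← (Finset.mem_filter.1 hA).2] at hs
      simpa using hs

/-- Sum one bump per hyperplane. The total is at least 3/4 on their union and at most 1/4 elsewhere;
one more unit subtracts the threshold 1/2. -/
lemma familyShatters_momentPoint {σ : ℝ → ℝ} {p : ℕ} (hσ : HasBump σ p) {q : ℕ} (hq : 0 < q)
    {m L d : ℕ} (hd : p * (m / q + 2 ^ L) + 1 ≤ d) :
    FamilyShatters d σ (momentPoint q m L) := by
  classical
  intro y
  obtain ⟨κ, _, w, hκ, hw⟩ := exists_hyperplanes hq m L y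
  obtain ⟨t₀, ht₀⟩ : ∃ t₀, σ t₀ ≠ 0 := by
    by_contra! h
    obtain ⟨a, β, c, h1, -⟩ := hσ ∅ (by simp) 1 one_pos
    simp [h] at h1
  set U : Finset ℝ :=
    (Finset.univ.image fun x : κ × (Fin m × Fin L) => w x.1 ⬝ᵥ momentPoint q m L x.2).erase 0
  set ε : ℝ := 1 / (4 * (Fintype.card κ + 1)) with hε
  have hε0 : 0 < ε := by positivity
  have hκε : Fintype.card κ * ε ≤ 1 / 4 := by
    rw [hε, mul_one_div, div_le_div_iff₀ (by positivity) (by norm_num)]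
    linarith
  obtain ⟨a, β, c, h1, h2⟩ := hσ U (by simp [U]) ε hε0
  -- The zeroth moment coordinate is constantly 1, so it supplies the biases that the network lacks.
  let e₀ : Fin (q + 1) ⊕ Fin L → ℝ := Pi.single (Sum.inl 0) 1
  have he₀ : ∀ t, e₀ ⬝ᵥ momentPoint q m L t = 1 := fun t => by
    simp [e₀, momentPoint]
  let G : ℝ → ℝ := fun u => ∑ i, c i * σ (a * u + β i)
  have hG0 : G 0 = 1 := by simpa [G] using h1
  refine ⟨(κ × Fin p) ⊕ Unit, inferInstance,
    Sum.elim (fun x => a • w x.1 + β x.2 • e₀) fun _ => t₀ • e₀,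
    Sum.elim (fun x => c x.2) fun _ => -(1 / 2) / σ t₀, ?_, fun t => ?_⟩
  · simp only [Fintype.card_sum, Fintype.card_prod, Fintype.card_fin, Fintype.card_unit]
    exact (Nat.add_le_add_right (by rw [mul_comm]; exact Nat.mul_le_mul_left p hκ) 1).trans hd
  have hsum : ∑ k : (κ × Fin p) ⊕ Unit,
      Sum.elim (fun x : κ × Fin p => c x.2) (fun _ => -(1 / 2) / σ t₀) k *
        σ (Sum.elim (fun x : κ × Fin p => a • w x.1 + β x.2 • e₀) (fun _ => t₀ • e₀) k ⬝ᵥ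
          momentPoint q m L t) = ∑ k, G (w k ⬝ᵥ momentPoint q m L t) - 1 / 2 := by
    simp only [Fintype.sum_sum_type, Fintype.sum_prod_type, Sum.elim_inl, Sum.elim_inr,
      add_dotProduct, smul_dotProduct, he₀, smul_eq_mul, mul_one, Finset.univ_unique,
      Finset.sum_const, Finset.card_singleton, one_smul, div_mul_cancel₀ _ ht₀, G]
    ring
  rw [hsum]
  have hsmall : ∀ k, w k ⬝ᵥ momentPoint q m L t ≠ 0 →
      |G (w k ⬝ᵥ momentPoint q m L t)| ≤ ε := fun k hk =>
    h2 _ (Finset.mem_erase.2 ⟨hk, Finset.mem_image.2 ⟨(k, t), Finset.mem_univ _, rfl⟩⟩)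
  have hcard : ∑ _k : κ, ε = Fintype.card κ * ε := by simp
  constructor
  · intro hy
    obtain ⟨k₀, hk₀⟩ := (hw t).1 hy
    have hge : ∀ k, (if k = k₀ then 1 else 0) - ε ≤ G (w k ⬝ᵥ momentPoint q m L t) := fun k => by
      by_cases hk : w k ⬝ᵥ momentPoint q m L t = 0
      · rw [hk, hG0]
        split_ifs <;> linarith
      · rw [if_neg fun h : k = k₀ => hk (h ▸ hk₀)]
        have := neg_le_of_abs_le (hsmall k hk)
        linarith
    have := Finset.sum_le_sum fun k (_ : k ∈ Finset.univ) => hge k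
    rw [Finset.sum_sub_distrib, hcard, Finset.sum_ite_eq' Finset.univ k₀ fun _ => (1 : ℝ),
      if_pos (Finset.mem_univ _)] at this
    linarith
  · intro hy
    have hle : ∀ k, G (w k ⬝ᵥ momentPoint q m L t) ≤ ε := fun k =>
      (le_abs_self _).trans (hsmall k fun hk => hy ((hw t).2 ⟨k, hk⟩))
    have := Finset.sum_le_sum fun k (_ : k ∈ Finset.univ) => hle k
    rw [hcard] at this
    linarith

lemma mul_le_natarajanDim_of_hasBump {σ : ℝ → ℝ} {p : ℕ} (hσ : HasBump σ p) {n d K q L : ℕ}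
    (hK : 2 ≤ K) {ψ : (Fin K → ℝ) → Option (Fin K)} (hψ : IsDecoder ψ) (hq : 0 < q)
    (hn : q + 1 + L ≤ n) (hd : p * (2 * 2 ^ L) + 1 ≤ d) :
    ((q * 2 ^ L * L : ℕ) : ℕ∞) ≤ natarajanDim (multiclass n d K σ Set.univ ψ) := by
  obtain ⟨e⟩ : Nonempty (Fin (q + 1) ⊕ Fin L ↪ Fin n) :=
    Function.Embedding.nonempty_of_card_le (by simpa using hn)
  have hF : FamilyShatters d σ (momentPoint q (q * 2 ^ L) L) :=
    familyShatters_momentPoint hσ hq (by rwa [Nat.mul_div_cancel_left _ hq, ← two_mul])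
  simpa using hF.card_le_natarajanDim hK e (fun _ => Set.mem_univ _) hψ

/-! ### Bounded integer inputs -/

/-- Point `(g, j)` of the shattered family: the tag of the group `g`, with entries `±1`, together
with the `j`-th unit vector. -/
def tagPoint {γ : Type*} {m : ℕ} (q : ℕ) (tag : γ → Fin m → Bool) (t : γ × Fin q) :
    Fin m ⊕ Fin q → ℝ :=
  Sum.elim (fun i => if tag t.1 i then 1 else -1) (Pi.single t.2 1)

lemma sum_sign_mul_sign_eq {m : ℕ} (a : Fin m → Bool) :
    ∑ i, (if a i then (1 : ℝ) else -1) * (if a i then 1 else -1) = m := by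
  rw [Finset.sum_congr rfl fun i _ => show _ = (1 : ℝ) by split_ifs <;> norm_num]
  simp

lemma sum_sign_mul_sign_le {m : ℕ} {a b : Fin m → Bool} (hab : a ≠ b) :
    ∑ i, (if a i then (1 : ℝ) else -1) * (if b i then 1 else -1) ≤ m - 2 := by
  classical
  obtain ⟨i₀, hi₀⟩ := Function.ne_iff.1 hab
  have hle : ∀ i, (if a i then (1 : ℝ) else -1) * (if b i then 1 else -1) ≤
      1 - if i = i₀ then 2 else 0 := fun i => by
    by_cases h : i = i₀
    · subst h
      rw [if_pos rfl]
      revert hi₀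
      cases a i <;> cases b i <;> norm_num
    · rw [if_neg h]
      split_ifs <;> norm_num
  refine (Finset.sum_le_sum fun i _ => hle i).trans_eq ?_
  rw [Finset.sum_sub_distrib, Finset.sum_ite_eq' Finset.univ i₀ fun _ => (2 : ℝ)]
  simp

/-- Unit `g` has pre-activation 1 or -1 on its own group, according to the label, and at most -3 on
other groups, since distinct sign vectors lose at least 2 in inner product. A steep slope makes the
units nearly 0 or 1; a unit with zero weights provides the threshold 1/2. -/
lemma familyShatters_tagPoint {γ : Type} [Fintype γ] {m d : ℕ} (q : ℕ) {tag : γ → Fin m → Bool}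
    (htag : Function.Injective tag) (hd : Fintype.card γ + 1 ≤ d) :
    FamilyShatters d Real.sigmoid (tagPoint q tag) := by
  classical
  intro y
  set ε : ℝ := 1 / (4 * (Fintype.card γ + 1)) with hε
  have hε0 : 0 < ε := by positivity
  have hγε : Fintype.card γ * ε ≤ 1 / 4 := by
    rw [hε, mul_one_div, div_le_div_iff₀ (by positivity) (by norm_num)]
    linarith
  have hε4 : ε ≤ 1 / 4 := by
    rw [hε]
    exact one_div_le_one_div_of_le (by norm_num) (by
      have : (0 : ℝ) ≤ Fintype.card γ := by positivity
      linarith)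
  obtain ⟨a, ha0, ha1, ha2⟩ : ∃ a : ℝ, 0 < a ∧ Real.sigmoid (-a) < ε ∧ 1 - ε < Real.sigmoid a :=
    ((Filter.eventually_gt_atTop 0).and
      (((Real.tendsto_sigmoid_atBot.comp Filter.tendsto_neg_atTop_atBot).eventually_lt_const
        hε0).and (Real.tendsto_sigmoid_atTop.eventually_const_lt (by linarith)))).exists
  let w : γ → Fin m ⊕ Fin q → ℝ := fun g =>
    Sum.elim (fun i => 2 * if tag g i then 1 else -1)
      fun j => -2 * m + if y (g, j) then 1 else -1
  have hw : ∀ g t, w g ⬝ᵥ tagPoint q tag t =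
      2 * (∑ i, (if tag g i then (1 : ℝ) else -1) * (if tag t.1 i then 1 else -1) - m) +
        if y (g, t.2) then 1 else -1 := fun g t => by
    simp only [w, tagPoint, sumElim_dotProduct_sumElim, dotProduct_single, mul_one]
    simp only [dotProduct, mul_assoc, ← Finset.mul_sum]
    ring
  have hpos : ∀ t, y t → w t.1 ⬝ᵥ tagPoint q tag t = 1 := fun t hy => by
    rw [hw, sum_sign_mul_sign_eq, if_pos hy]
    ring
  have hneg : ∀ g t, ¬ (g = t.1 ∧ y t) → w g ⬝ᵥ tagPoint q tag t ≤ -1 := fun g t h => by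
    rw [hw]
    by_cases hg : g = t.1
    · subst hg
      rw [sum_sign_mul_sign_eq, if_neg fun hy => h ⟨rfl, hy⟩]
      linarith
    · have := sum_sign_mul_sign_le (htag.ne hg)
      split_ifs <;> linarith
  refine ⟨γ ⊕ Unit, inferInstance, Sum.elim (fun g => a • w g) fun _ => 0,
    Sum.elim (fun _ => 1) fun _ => -1, by simpa using hd, fun t => ?_⟩
  simp only [Fintype.sum_sum_type, Sum.elim_inl, Sum.elim_inr, smul_dotProduct, smul_eq_mul,
    zero_dotProduct, Real.sigmoid_zero, Finset.univ_unique, Finset.sum_const,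
    Finset.card_singleton, one_smul, one_mul]
  constructor
  · intro hy
    have h1 : Real.sigmoid (a * (w t.1 ⬝ᵥ tagPoint q tag t)) ≤
        ∑ g, Real.sigmoid (a * (w g ⬝ᵥ tagPoint q tag t)) :=
      Finset.single_le_sum (f := fun g => Real.sigmoid (a * (w g ⬝ᵥ tagPoint q tag t)))
        (fun _ _ => Real.sigmoid_nonneg _) (Finset.mem_univ t.1)
    rw [hpos t hy, mul_one] at h1
    linarith
  · intro hy
    have h1 : ∑ g, Real.sigmoid (a * (w g ⬝ᵥ tagPoint q tag t)) ≤ ∑ _g : γ, ε :=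
      Finset.sum_le_sum fun g _ => (Real.sigmoid_le (by
        have := mul_le_mul_of_nonneg_left (hneg g t fun h => hy h.2) ha0.le
        linarith)).trans ha1.le
    have hcard : ∑ _g : γ, ε = Fintype.card γ * ε := by simp
    rw [hcard] at h1
    linarith

lemma extend_tagPoint_mem {γ : Type*} {m q n M : ℕ} (hM : 1 ≤ M) (tag : γ → Fin m → Bool)
    (e : Fin m ⊕ Fin q ↪ Fin n) (t : γ × Fin q) :
    Function.extend e (tagPoint q tag t) 0 ∈ boundedIntInputs n M := by
  have hM' : (1 : ℤ) ≤ M := by exact_mod_cast hM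
  have key : ∀ i, ∃ z : ℤ, Function.extend e (tagPoint q tag t) 0 i = z ∧ |z| ≤ M := fun i => by
    by_cases hi : ∃ j, e j = i
    · obtain ⟨j, rfl⟩ := hi
      rw [e.injective.extend_apply]
      rcases j with j | j
      · refine ⟨if tag t.1 j then 1 else -1, ?_, ?_⟩
        · simp [tagPoint]
        · split_ifs <;> simpa using hM
      · refine ⟨(Pi.single t.2 1 : Fin q → ℤ) j, ?_, ?_⟩
        · simp only [tagPoint, Sum.elim_inr, Pi.single_apply]
          split_ifs <;> simp
        · rw [Pi.single_apply]
          split_ifs <;> simp [hM]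
    · rw [Function.extend_apply' _ _ _ hi]
      exact ⟨0, by simp, by simp⟩
  choose z hz using key
  exact ⟨z, hz⟩

lemma mul_le_natarajanDim_sigmoid {n d K m q M : ℕ} (hK : 2 ≤ K) (hM : 1 ≤ M)
    {ψ : (Fin K → ℝ) → Option (Fin K)} (hψ : IsDecoder ψ) (hn : m + q ≤ n) (hd : 1 ≤ d)
    (hdm : d ≤ 2 ^ m) :
    (((d - 1) * q : ℕ) : ℕ∞) ≤
      natarajanDim (multiclass n d K Real.sigmoid (boundedIntInputs n M) ψ) := by
  obtain ⟨e⟩ : Nonempty (Fin m ⊕ Fin q ↪ Fin n) :=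
    Function.Embedding.nonempty_of_card_le (by simpa using hn)
  obtain ⟨tag⟩ : Nonempty (Fin (d - 1) ↪ (Fin m → Bool)) :=
    Function.Embedding.nonempty_of_card_le (by simpa using (Nat.sub_le d 1).trans hdm)
  have hF : FamilyShatters d Real.sigmoid (tagPoint q tag) :=
    familyShatters_tagPoint q tag.injective (by simp; omega)
  simpa using hF.card_le_natarajanDim hK e (extend_tagPoint_mem hM tag e) hψ

/-! ### Sine -/

/-- Induct on the shifted pattern. The angles `θ / 2` and `θ / 2 + π` have opposite sines and the
same double modulo `2π`, so one of them gives the first sign and keeps the later ones. Carrying `sin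
θ ≠ 0` ensures `sin (θ / 2) ≠ 0`. -/
lemma exists_sin_sign_pattern (N : ℕ) (y : ℕ → Prop) :
    ∃ θ : ℝ, Real.sin θ ≠ 0 ∧ ∀ i < N,
      (y i → 0 < Real.sin (θ * 2 ^ i)) ∧ (¬ y i → Real.sin (θ * 2 ^ i) < 0) := by
  induction N generalizing y with
  | zero => exact ⟨Real.pi / 2, by simp, fun i hi => absurd hi (Nat.not_lt_zero i)⟩
  | succ N ih =>
    obtain ⟨θ, h0, h⟩ := ih fun i => y (i + 1)
    have hhalf : Real.sin (θ / 2) ≠ 0 := fun hz => h0 (by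
      rw [← add_halves θ, ← two_mul, Real.sin_two_mul, hz]
      ring)
    have hstep : ∃ φ : ℝ, ((y 0 → 0 < Real.sin φ) ∧ (¬ y 0 → Real.sin φ < 0)) ∧
        ∃ k : ℕ, φ * 2 = θ + k * (2 * Real.pi) := by
      have hpi : Real.sin (θ / 2 + Real.pi) = -Real.sin (θ / 2) := Real.sin_add_pi _
      have e1 : θ / 2 * 2 = θ + (0 : ℕ) * (2 * Real.pi) := by push_cast; ring
      have e2 : (θ / 2 + Real.pi) * 2 = θ + (1 : ℕ) * (2 * Real.pi) := by push_cast; ring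
      rcases hhalf.lt_or_gt with hs | hs <;> by_cases hy : y 0
      · exact ⟨_, ⟨fun _ => by rw [hpi]; linarith, fun h => absurd hy h⟩, 1, e2⟩
      · exact ⟨_, ⟨fun h => absurd h hy, fun _ => hs⟩, 0, e1⟩
      · exact ⟨_, ⟨fun _ => hs, fun h => absurd hy h⟩, 0, e1⟩
      · exact ⟨_, ⟨fun h => absurd h hy, fun _ => by rw [hpi]; linarith⟩, 1, e2⟩
    obtain ⟨φ, hφ, k, hk⟩ := hstep
    refine ⟨φ, ?_, fun i hi => ?_⟩
    · by_cases hy : y 0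
      · exact (hφ.1 hy).ne'
      · exact (hφ.2 hy).ne
    · cases i with
      | zero => simpa using hφ
      | succ i =>
        have : Real.sin (φ * 2 ^ (i + 1)) = Real.sin (θ * 2 ^ i) := by
          rw [pow_succ', ← mul_assoc, hk]
          have := Real.sin_add_nat_mul_two_pi (θ * 2 ^ i) (k * 2 ^ i)
          rw [← this]
          push_cast
          ring_nf
        rw [this]
        exact h i (Nat.lt_of_succ_lt_succ hi)

lemma natarajanDim_sin_eq_top {n d K : ℕ} (hn : 1 ≤ n) (hd : 1 ≤ d) (hK : 2 ≤ K)
    {ψ : (Fin K → ℝ) → Option (Fin K)} (hψ : IsDecoder ψ) :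
    natarajanDim (multiclass n d K Real.sin (intInputs n) ψ) = ⊤ := by
  refine ENat.eq_top_iff_forall_ge.2 fun N => ?_
  let P : Fin N → Unit → ℝ := fun i _ => 2 ^ (i : ℕ)
  have hF : FamilyShatters d Real.sin P := by
    intro y
    obtain ⟨θ, -, h⟩ := exists_sin_sign_pattern N fun i => ∃ hi : i < N, y ⟨i, hi⟩
    refine ⟨Unit, inferInstance, fun _ _ => θ, fun _ => 1, by simpa using hd, fun t => ?_⟩
    simpa [P, dotProduct] using h t t.2
  let e : Unit ↪ Fin n := ⟨fun _ => ⟨0, hn⟩, fun _ _ _ => rfl⟩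
  have hX : ∀ t, Function.extend e (P t) 0 ∈ intInputs n := fun t => by
    refine ⟨Function.extend e (fun _ => 2 ^ (t : ℕ)) 0, fun i => ?_⟩
    by_cases hi : ∃ j, e j = i
    · obtain ⟨j, rfl⟩ := hi
      simp [e.injective.extend_apply, P]
    · simp [Function.extend_apply' _ _ _ hi]
  simpa using hF.card_le_natarajanDim hK e hX hψ

/-! ### Asymptotics -/

/-- Since `W = d (n + K)`, the bound on `d` gives `n + K ≥ W ^ α`, which for large `W` dominates
both `K` and `log W`. -/
lemma eventually_params (K : ℕ) {α : ℝ} (hα : 0 < α) (B : ℝ) :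
    ∃ W₀ : ℕ, ∀ n d W : ℕ, W = numParams n d K → W₀ ≤ W → (d : ℝ) ≤ (W : ℝ) ^ (1 - α) →
      1 ≤ W ∧ B ≤ (W : ℝ) ^ (α / 2) ∧ (1 ≤ d → (W : ℝ) ≤ 2 * (d * n) ∧
        4 * Real.log d + 4 ≤ n) := by
  have h1 : ∀ᶠ x : ℝ in Filter.atTop, 1 ≤ x := Filter.eventually_ge_atTop 1
  have h2 : ∀ᶠ x : ℝ in Filter.atTop, B ≤ x ^ (α / 2) :=
    (tendsto_rpow_atTop (half_pos hα)).eventually_ge_atTop B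
  have h3 : ∀ᶠ x : ℝ in Filter.atTop, 2 * (K : ℝ) + 16 ≤ x ^ α :=
    (tendsto_rpow_atTop hα).eventually_ge_atTop _
  have h4 : ∀ᶠ x : ℝ in Filter.atTop, ‖Real.log x‖ ≤ 1 / 16 * ‖x ^ α‖ :=
    (isLittleO_log_rpow_atTop hα).bound (by norm_num)
  obtain ⟨W₀, hW₀⟩ := Filter.eventually_atTop.1
    (tendsto_natCast_atTop_atTop.eventually (h1.and (h2.and (h3.and h4))))
  refine ⟨W₀, fun n d W hW hge hd => ?_⟩
  obtain ⟨hW1, hB, hK, hlog⟩ := hW₀ W hge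
  refine ⟨by exact_mod_cast hW1, hB, fun hd1 => ?_⟩
  have hW0 : (0 : ℝ) < W := by linarith
  have hd0 : (1 : ℝ) ≤ d := by exact_mod_cast hd1
  rw [Real.norm_of_nonneg (Real.log_nonneg hW1),
    Real.norm_of_nonneg (Real.rpow_nonneg hW0.le α)] at hlog
  have hWeq : (W : ℝ) = d * (n + K) := by
    rw [hW, numParams]
    push_cast
    ring
  have hnK : (W : ℝ) ^ α ≤ n + K := by
    refine le_of_mul_le_mul_left ?_ (by linarith : (0 : ℝ) < d)
    calc (d : ℝ) * (W : ℝ) ^ α ≤ (W : ℝ) ^ (1 - α) * (W : ℝ) ^ α :=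
          mul_le_mul_of_nonneg_right hd (Real.rpow_nonneg hW0.le α)
      _ = W := by rw [← Real.rpow_add hW0, sub_add_cancel, Real.rpow_one]
      _ = _ := hWeq
  have hKn : (K : ℝ) ≤ n := by linarith
  have hn1 : (1 : ℝ) ≤ n + K := by linarith
  have hdW : (d : ℝ) ≤ W := by
    rw [hWeq]
    exact le_mul_of_one_le_right (by linarith) hn1
  have hlogd : Real.log d ≤ Real.log W := Real.log_le_log (by linarith) hdW
  exact ⟨by rw [hWeq]; nlinarith, by linarith⟩

lemma natLog_two_le (d : ℕ) (hd : 1 ≤ d) : (Nat.log 2 d : ℝ) ≤ 2 * Real.log d := by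
  have h : ((2 : ℝ)) ^ Nat.log 2 d ≤ d := by exact_mod_cast Nat.pow_log_le_self 2 (by omega)
  have h2 := Real.log_le_log (by positivity) h
  rw [Real.log_pow] at h2
  have h3 := Real.log_two_gt_d9
  have h4 : (0 : ℝ) ≤ Nat.log 2 d := by positivity
  nlinarith

lemma ofReal_le_of_natCast_le {c : ℝ} {N : ℕ} {x : ℕ∞} (hc : c ≤ N) (hN : (N : ℕ∞) ≤ x) :
    ENNReal.ofReal c ≤ (x : ℝ≥0∞) := by
  refine (ENNReal.ofReal_le_ofReal hc).trans ?_
  rw [ENNReal.ofReal_natCast, ← ENat.toENNReal_coe]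
  exact ENat.toENNReal_le.2 hN

/-- An activation with bumps of `p` units has Natarajan dimension of order `W log W`. -/
lemma exists_threshold_of_hasBump {p : ℕ} (hp : 1 ≤ p) {K : ℕ} (hK : 2 ≤ K) {α : ℝ}
    (hα : 0 < α) :
    ∃ W₀ : ℕ, ∀ σ : ℝ → ℝ, HasBump σ p → ∀ ψ : (Fin K → ℝ) → Option (Fin K), IsDecoder ψ →
      ∀ n d W : ℕ, W = numParams n d K → W₀ ≤ W →
        (W : ℝ) ^ α ≤ d → (d : ℝ) ≤ (W : ℝ) ^ (1 - α) →
        ENNReal.ofReal (1 / (48 * p) * α * (W * Real.log W)) ≤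
          (natarajanDim (multiclass n d K σ Set.univ ψ) : ℝ≥0∞) := by
  obtain ⟨W₀, hW₀⟩ := eventually_params K hα (6 * p)
  refine ⟨W₀, fun σ hσ ψ hψ n d W hW hge hd1 hd2 => ?_⟩
  obtain ⟨hW1, hx, hrest⟩ := hW₀ n d W hW hge hd2
  have hW1' : (1 : ℝ) ≤ W := by exact_mod_cast hW1
  have hW0 : (0 : ℝ) < W := by linarith
  have hdpos : (0 : ℝ) < d := (Real.rpow_pos_of_pos hW0 α).trans_le hd1
  have hd0 : 1 ≤ d := by exact_mod_cast hdpos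
  obtain ⟨hdn, hn⟩ := hrest hd0
  have hp' : (1 : ℝ) ≤ p := by exact_mod_cast hp
  set x : ℝ := (W : ℝ) ^ (α / 2) with hxdef
  have hx0 : 0 < x := Real.rpow_pos_of_pos hW0 _
  have hxx : x * x ≤ d := by
    rw [hxdef, ← Real.rpow_add hW0, add_halves]
    exact hd1
  have hlogx : Real.log x = α / 2 * Real.log W := Real.log_rpow hW0 _
  have hlogW : 0 ≤ Real.log W := Real.log_nonneg hW1'
  -- With `2 ^ L ≤ d / (3 * p)`, the `2 * p * 2 ^ L` bump units and the threshold unit fit into `d`.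
  set D := d / (3 * p) with hD
  set L := Nat.log 2 D with hL
  have hDd : D * (3 * p) ≤ d := Nat.div_mul_le_self _ _
  have hdD : (d : ℝ) < (D + 1) * (3 * p) := by
    have : d < (D + 1) * (3 * p) := by
      rw [← Nat.div_lt_iff_lt_mul (by positivity)]
      exact Nat.lt_succ_self _
    exact_mod_cast this
  have hD0 : D ≠ 0 := fun h0 => by
    rw [h0] at hdD
    push_cast at hdD
    nlinarith
  have hLD : 2 ^ L ≤ D := Nat.pow_log_le_self 2 hD0
  have hDL : D + 1 ≤ 2 * 2 ^ L := by
    rw [← pow_succ']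
    exact Nat.lt_pow_succ_log_self one_lt_two D
  have hd6 : (d : ℝ) ≤ 2 ^ L * (6 * p) := by
    have h : ((D : ℝ) + 1) ≤ 2 * 2 ^ L := by exact_mod_cast hDL
    nlinarith
  -- From `x * x ≤ d ≤ 2 ^ L * (6 * p)` and `6 * p ≤ x`: half of the exponent `α` pays for the
  -- constant.
  have hx2 : x ≤ 2 ^ L := by
    refine le_of_mul_le_mul_right (hxx.trans (hd6.trans ?_)) hx0
    exact mul_le_mul_of_nonneg_left hx (by positivity)
  have hLlow : α / 2 * Real.log W ≤ L := by
    have h := Real.log_le_log hx0 hx2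
    rw [hlogx, Real.log_pow] at h
    have h3 := Real.log_two_lt_d9
    have h4 : (0 : ℝ) ≤ L := by positivity
    nlinarith
  have hLup : (L : ℝ) ≤ 2 * Real.log d :=
    (Nat.cast_le.2 (Nat.log_mono_right (Nat.div_le_self _ _))).trans (natLog_two_le d hd0)
  have hlogd : 0 ≤ Real.log d := Real.log_natCast_nonneg d
  have hLn : 1 + L ≤ n := by
    have : (1 : ℝ) + L ≤ n := by linarith
    exact_mod_cast this
  obtain ⟨q, rfl⟩ := Nat.exists_eq_add_of_le hLn
  push_cast at hn hdn
  have hqn : ((1 : ℝ) + L + q) / 2 ≤ q := by linarith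
  have hq : 0 < q := by
    have : (0 : ℝ) < q := by linarith
    exact_mod_cast this
  have hcount : p * (2 * 2 ^ L) + 1 ≤ d := by
    have h1 : 1 ≤ p * 2 ^ L := Nat.mul_pos hp (by positivity)
    have h2 := Nat.mul_le_mul_right (3 * p) hLD
    calc p * (2 * 2 ^ L) + 1 ≤ p * (2 * 2 ^ L) + p * 2 ^ L := Nat.add_le_add_left h1 _
      _ = 2 ^ L * (3 * p) := by ring
      _ ≤ d := h2.trans hDd
  refine ofReal_le_of_natCast_le ?_
    (mul_le_natarajanDim_of_hasBump hσ hK hψ hq (by omega : q + 1 + L ≤ _) hcount)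
  push_cast
  -- The 48 collects `W ≤ 2 d n`, `q ≥ n / 2`, `2 ^ L ≥ d / (6 p)` and `L ≥ (α / 2) log W`.
  calc 1 / (48 * (p : ℝ)) * α * (W * Real.log W)
      ≤ 1 / (48 * (p : ℝ)) * α * (2 * (d * (1 + L + q)) * Real.log W) := by gcongr
    _ = (1 + L + q) / 2 * (d / (6 * p)) * (α / 2 * Real.log W) := by
        field_simp
        ring
    _ ≤ q * 2 ^ L * L := by
        have h6 : (d : ℝ) / (6 * p) ≤ 2 ^ L := by
          rw [div_le_iff₀ (by positivity)]
          exact hd6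
        gcongr

/-- The sigmoid on bounded integer inputs has Natarajan dimension of order `W`. -/
lemma exists_threshold_sigmoid_int {K : ℕ} (hK : 2 ≤ K) {α : ℝ} (hα : 0 < α) :
    ∃ W₀ : ℕ, ∀ M : ℕ, 1 ≤ M → ∀ ψ : (Fin K → ℝ) → Option (Fin K), IsDecoder ψ →
      ∀ n d W : ℕ, W = numParams n d K → W₀ ≤ W →
        2 ≤ d → (d : ℝ) ≤ (W : ℝ) ^ (1 - α) →
        ENNReal.ofReal (1 / 8 * W) ≤
          (natarajanDim (multiclass n d K Real.sigmoid (boundedIntInputs n M) ψ) : ℝ≥0∞) := by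
  obtain ⟨W₀, hW₀⟩ := eventually_params K hα 0
  refine ⟨W₀, fun M hM ψ hψ n d W hW hge hd1 hd2 => ?_⟩
  obtain ⟨-, -, hrest⟩ := hW₀ n d W hW hge hd2
  have hd0 : 1 ≤ d := by omega
  obtain ⟨hdn, hn⟩ := hrest hd0
  have hd1' : (2 : ℝ) ≤ d := by exact_mod_cast hd1
  have hL := natLog_two_le d hd0
  have hlogd : 0 ≤ Real.log d := Real.log_natCast_nonneg d
  have hmn : Nat.log 2 d + 1 ≤ n := by
    have : (Nat.log 2 d : ℝ) + 1 ≤ n := by linarith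
    exact_mod_cast this
  obtain ⟨q, hq⟩ := Nat.exists_eq_add_of_le hmn
  refine ofReal_le_of_natCast_le ?_ (mul_le_natarajanDim_sigmoid hK hM hψ hq.ge hd0
    (Nat.lt_pow_succ_log_self one_lt_two d).le)
  have hq' : (n : ℝ) = Nat.log 2 d + 1 + q := by exact_mod_cast hq
  push_cast [Nat.cast_sub hd0]
  -- Each of `W ≤ 2 d n`, `d - 1 ≥ d / 2` and `q ≥ n / 2` costs a factor 2.
  calc 1 / 8 * (W : ℝ) ≤ 1 / 8 * (2 * (d * n)) := by gcongr
    _ = (d / 2) * (n / 2) := by ring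
    _ ≤ (d - 1) * q := by gcongr <;> linarith

end TwoLayer

theorem mainTheorem11 :
    -- the comparison with the binary class, for every argmax decoder
    (∀ (n d K : ℕ), 2 ≤ K → ∀ (σ : ℝ → ℝ) (X : Set (Fin n → ℝ))
      (ψ : (Fin K → ℝ) → Option (Fin K)), TwoLayer.IsArgmaxDecoder ψ →
      TwoLayer.vcDim (TwoLayer.halfspaceClass n d σ X) ≤
        TwoLayer.natarajanDim (TwoLayer.multiclass n d K σ X ψ)) ∧
    -- the comparison for the strict decoder, for positive activations
    (∀ (n d K : ℕ), 2 ≤ K → ∀ (σ : ℝ → ℝ), (∀ t, 0 < σ t) → ∀ (X : Set (Fin n → ℝ)),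
      TwoLayer.vcDim (TwoLayer.halfspaceClass n d σ X) ≤
        TwoLayer.natarajanDim (TwoLayer.multiclass n d K σ X TwoLayer.uargmax)) ∧
    -- piecewise linear activations, real inputs
    (∃ c : ℝ, 0 < c ∧ ∀ K : ℕ, 2 ≤ K → ∀ α : ℝ, 0 < α → ∃ W₀ : ℕ,
      ∀ σ : ℝ → ℝ, TwoLayer.IsPiecewiseLinear σ → (¬ ∃ a b : ℝ, ∀ t, σ t = a * t + b) →
      ∀ ψ : (Fin K → ℝ) → Option (Fin K), TwoLayer.IsDecoder ψ →
      ∀ n d W : ℕ, W = TwoLayer.numParams n d K → W₀ ≤ W →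
        (W : ℝ) ^ α ≤ d → (d : ℝ) ≤ (W : ℝ) ^ (1 - α) →
        ENNReal.ofReal (c * α * (W * Real.log W)) ≤
          (TwoLayer.natarajanDim (TwoLayer.multiclass n d K σ Set.univ ψ) : ℝ≥0∞)) ∧
    -- piecewise polynomial activations, real inputs
    (∀ r : ℕ, ∃ c : ℝ, 0 < c ∧ ∀ K : ℕ, 2 ≤ K → ∀ α : ℝ, 0 < α → ∃ W₀ : ℕ,
      ∀ σ : ℝ → ℝ, TwoLayer.IsPiecewisePolynomial r σ →
      (¬ ∃ P : Polynomial ℝ, ∀ t, σ t = P.eval t) →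
      ∀ ψ : (Fin K → ℝ) → Option (Fin K), TwoLayer.IsDecoder ψ →
      ∀ n d W : ℕ, W = TwoLayer.numParams n d K → W₀ ≤ W →
        (W : ℝ) ^ α ≤ d → (d : ℝ) ≤ (W : ℝ) ^ (1 - α) →
        ENNReal.ofReal (c * α * (W * Real.log W)) ≤
          (TwoLayer.natarajanDim (TwoLayer.multiclass n d K σ Set.univ ψ) : ℝ≥0∞)) ∧
    -- standard sigmoid, real inputs
    (∃ c : ℝ, 0 < c ∧ ∀ K : ℕ, 2 ≤ K → ∀ α : ℝ, 0 < α → ∃ W₀ : ℕ,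
      ∀ ψ : (Fin K → ℝ) → Option (Fin K), TwoLayer.IsDecoder ψ →
      ∀ n d W : ℕ, W = TwoLayer.numParams n d K → W₀ ≤ W →
        (W : ℝ) ^ α ≤ d → (d : ℝ) ≤ (W : ℝ) ^ (1 - α) →
        ENNReal.ofReal (c * α * (W * Real.log W)) ≤
          (TwoLayer.natarajanDim
            (TwoLayer.multiclass n d K Real.sigmoid Set.univ ψ) : ℝ≥0∞)) ∧
    -- standard sigmoid, bounded integer inputs
    (∃ c : ℝ, 0 < c ∧ ∀ K : ℕ, 2 ≤ K → ∀ α : ℝ, 0 < α → ∃ W₀ : ℕ,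
      ∀ M : ℕ, 1 ≤ M →
      ∀ ψ : (Fin K → ℝ) → Option (Fin K), TwoLayer.IsDecoder ψ →
      ∀ n d W : ℕ, W = TwoLayer.numParams n d K → W₀ ≤ W →
        2 ≤ d → (d : ℝ) ≤ (W : ℝ) ^ (1 - α) →
        ENNReal.ofReal (c * W) ≤
          (TwoLayer.natarajanDim
            (TwoLayer.multiclass n d K Real.sigmoid
              (TwoLayer.boundedIntInputs n M) ψ) : ℝ≥0∞)) ∧
    -- sine, unbounded integer inputs
    (∀ n d K : ℕ, 1 ≤ n → 1 ≤ d → 2 ≤ K →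
      ∀ ψ : (Fin K → ℝ) → Option (Fin K), TwoLayer.IsDecoder ψ →
        TwoLayer.natarajanDim
          (TwoLayer.multiclass n d K Real.sin (TwoLayer.intInputs n) ψ) = ⊤) := by
  refine ⟨fun n d K hK σ X ψ hψ => TwoLayer.vcDim_le_natarajanDim fun S hS =>
      TwoLayer.nShatters_of_vcShatters_of_isArgmaxDecoder hK hψ hS,
    fun n d K hK σ hσ X => TwoLayer.vcDim_le_natarajanDim fun S hS =>
      (TwoLayer.strictShatters_of_vcShatters hσ hS).nShatters hK (Or.inl rfl),
    ⟨1 / (48 * (3 : ℕ)), by positivity, fun K hK α hα => ?_⟩,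
    fun r => ⟨1 / (48 * (r + 2 : ℕ)), by positivity, fun K hK α hα => ?_⟩,
    ⟨1 / (48 * (2 : ℕ)), by positivity, fun K hK α hα => ?_⟩,
    ⟨1 / 8, by positivity, fun K hK α hα => TwoLayer.exists_threshold_sigmoid_int hK hα⟩,
    fun n d K hn hd hK ψ hψ => TwoLayer.natarajanDim_sin_eq_top hn hd hK hψ⟩
  · obtain ⟨W₀, h⟩ := TwoLayer.exists_threshold_of_hasBump (p := 3) (by norm_num) hK hα
    refine ⟨W₀, fun σ hσ hne => h σ (TwoLayer.hasBump_of_isPiecewisePolynomial hσ ?_)⟩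
    rintro ⟨P, hP, hσP⟩
    refine hne ⟨P.coeff 1, P.coeff 0, fun t => ?_⟩
    rw [hσP, Polynomial.eval_eq_sum_range' (Nat.lt_succ_of_le hP), Finset.sum_range_succ,
      Finset.sum_range_one]
    ring
  · obtain ⟨W₀, h⟩ := TwoLayer.exists_threshold_of_hasBump (p := r + 2) (by omega) hK hα
    refine ⟨W₀, fun σ hσ hne => h σ (TwoLayer.hasBump_of_isPiecewisePolynomial hσ ?_)⟩
    rintro ⟨P, -, hσP⟩
    exact hne ⟨P, hσP⟩
  · obtain ⟨W₀, h⟩ := TwoLayer.exists_threshold_of_hasBump (p := 2) (by norm_num) hK hα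
    exact ⟨W₀, h _ TwoLayer.hasBump_sigmoid⟩
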